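/- Let $\omega=\{0,1,2,\dots\}$, let ${}^{<\omega}\omega$ and ${}^{\omega}\omega$ be the sets of finite and infinite strings over $\omega$, and write $p\!\upharpoonright\! n$ for the prefix of length $n$ of $p\in{}^{\omega}\omega$. A *tree* is a set $T\subseteq{}^{<\omega}\omega$ that contains the empty string and is closed under initial segments; $[T]$ is the set of $p\in{}^{\omega}\omega$ with $p\!\upharpoonright\! n\in T$ for all $n$. For $\mathcal V\subseteq\mathcal P(\omega)$ upward closed under $\subseteq$, a tree $T$ is *$\mathcal V$-branching* if $\{n\in\omega\mid \sigma^\smallfrown n\in T\}\in\mathcal V$ for every $\sigma\in T$. A *partial continuous function* $\Phi:\subseteq{}^{\omega}\omega\to\omega$ is a partial function for which there is a partial function $\varphi:\subseteq{}^{<\omega}\omega\to\omega$ such that $\varphi(\sigma)=\varphi(\tau)$ whenever $\sigma,\tau\in\mathrm{dom}(\varphi)$ and $\sigma$ is a prefix of $\tau$, and such that, for all $p$ and $c$: $p\in\mathrm{dom}(\Phi)$ and $\Phi(p)=c$ if and only if there is $n$ with $p\!\upharpoonright\! n\in\mathrm{dom}(\varphi)$ and $\varphi(p\!\upharpoonright\!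 n)=c$. For upward closed families $\mathcal U,\mathcal V\subseteq\mathcal P(\omega)$, write $\mathcal U\leq_{\mathrm{LT}}^{\mathsf o}\mathcal V$ (the *Gamified Katětov order*) if there is a partial continuous function $\Phi:\subseteq{}^{\omega}\omega\to\omega$ such that for every $A\in\mathcal U$ there is a $\mathcal V$-branching tree $T$ with $[T]\subseteq\mathrm{dom}(\Phi)$ and $\Phi(p)\in A$ for all $p\in[T]$. For downward closed families (in particular ideals) $\mathcal I,\mathcal J\subseteq\mathcal P(\omega)$, write $\mathcal I\leq_{\mathrm{LT}}^{\mathsf o}\mathcal J$ if $\mathcal I^*\leq_{\mathrm{LT}}^{\mathsf o}\mathcal J^*$, where $\mathcal I^*=\{A\subseteq\omega\mid\omega\setminus A\in\mathcal I\}$. Let $$\mathrm{Sum}_{1/n}=\Big\{A\subseteq\omega\ \Big|\ \sum_{n\in A}\tfrac1{n+1}<\infty\Big\}$$ be the canonical summable ideal and $$\mathcal H=\{A\subseteq\omega\mid \mathrm{FS}(B)\not\subseteq A\text{ for every infinite }B\subseteq\omega\}$$ the Hindman ideal, where $\mathrm{FS}(B)=\{\sum_{n\in F}n\mid F\subseteq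 B\text{ finite and non-empty}\}$. **Theorem.** $\mathrm{Sum}_{1/n}$ and $\mathcal H$ are incomparable in the Gamified Katětov order, that is, $$\mathrm{Sum}_{1/n}\not\leq_{\mathrm{LT}}^{\mathsf o}\mathcal H\qquad\text{and}\qquad\mathcal H\not\leq_{\mathrm{LT}}^{\mathsf o}\mathrm{Sum}_{1/n}.$$ -/

import Mathlib

namespace GamifiedKatetov

/-- The prefix `(p 0, …, p (n - 1))` of length `n` of an infinite string `p`. -/
def initSeg (p : ℕ → ℕ) (n : ℕ) : List ℕ := (List.range n).map p

/-- A partial function on infinite strings is (partial) continuous if it is induced by a coherent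
partial function `φ` on finite strings. -/
def IsPartialContinuous (Φ : (ℕ → ℕ) →. ℕ) : Prop :=
  ∃ φ : List ℕ →. ℕ,
    (∀ (σ τ : List ℕ) (c d : ℕ), c ∈ φ σ → d ∈ φ τ → σ <+: τ → c = d) ∧
    ∀ (p : ℕ → ℕ) (c : ℕ), c ∈ Φ p ↔ ∃ n : ℕ, c ∈ φ (initSeg p n)

/-- A tree of finite strings: it contains the root and is closed under initial segments. -/
structure IsTree (T : Set (List ℕ)) : Prop where
  root_mem : [] ∈ T
  mem_of_prefix : ∀ σ τ : List ℕ, τ <+: σ → σ ∈ T → τ ∈ T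

/-- The set `[T]` of infinite paths through `T`. -/
def paths (T : Set (List ℕ)) : Set (ℕ → ℕ) := {p | ∀ n : ℕ, initSeg p n ∈ T}

/-- A `V`-branching tree: at every node, the set of immediate successors belongs to `V`. -/
structure IsBranchingTree (V : UpperSet (Set ℕ)) (T : Set (List ℕ)) : Prop where
  isTree : IsTree T
  branching : ∀ σ ∈ T, {n : ℕ | σ ++ [n] ∈ T} ∈ V

/-- The Gamified Katětov order on upper sets. -/
def UpperLE (U V : UpperSet (Set ℕ)) : Prop :=
  ∃ Φ : (ℕ → ℕ) →. ℕ, IsPartialContinuous Φ ∧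
    ∀ A ∈ U, ∃ T : Set (List ℕ), IsBranchingTree V T ∧
      paths T ⊆ Φ.Dom ∧ ∀ p ∈ paths T, ∀ c ∈ Φ p, c ∈ A

/-- The dual upper set `{A | ω \ A ∈ I}` of a lower set `I`. -/
def dual (I : LowerSet (Set ℕ)) : UpperSet (Set ℕ) where
  carrier := {A | Aᶜ ∈ I}
  upper' := fun _ _ hAB hA => I.lower (Set.compl_subset_compl.mpr hAB) hA

/-- The Gamified Katětov order on lower sets, in particular on ideals. -/
def LowerLE (I J : LowerSet (Set ℕ)) : Prop := UpperLE (dual I) (dual J)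

/-- The canonical summable ideal: the sets `A` with `∑_{n ∈ A} 1 / (n + 1) < ∞`. -/
def canonicalSummableIdeal : LowerSet (Set ℕ) where
  carrier := {A | Summable fun n : A => 1 / (((n : ℕ) : ℝ) + 1)}
  lower' := by
    intro A B hBA hA
    have h : Summable fun n : A => 1 / (((n : ℕ) : ℝ) + 1) := hA
    exact h.comp_injective (i := Set.inclusion hBA) (Set.inclusion_injective hBA)

/-- The set of sums of non-empty finite sets of (distinct) elements of `A`. -/
def finiteSums (A : Set ℕ) : Set ℕ :=
  {x | ∃ F : Finset ℕ, F.Nonempty ∧ (F : Set ℕ) ⊆ A ∧ x = ∑ n ∈ F, n}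

/-- The Hindman ideal: the sets that contain `finiteSums B` for no infinite `B`. -/
def hindmanIdeal : LowerSet (Set ℕ) where
  carrier := {A | ∀ B : Set ℕ, B.Infinite → ¬ finiteSums B ⊆ A}
  lower' := fun _ _ hCA hA B hB h => hA B hB (h.trans hCA)

end GamifiedKatetov

/-!
Call a set of values unavoidable at a node if every tree through that node that branches into the
dual of `J` has a path on which `Φ` takes a value in the set. To refute `I ≤ J` it suffices to find
a set in `I` that is unavoidable at the root. The unavoidable families are followed to the root
along the well-founded tree of undecided nodes: each of them is given a limit point in a compact
space, and the limit point at a node is an ultralimit of those at its successors.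

For the first half the limit points lie in `ℕ∞`: there are unavoidable sets that consist of at most
one point and a set of arbitrarily small measure. The ultrafilter is idempotent, and the infinite
set `B` whose finite sums index the successors is built by the Galvin–Glazer argument, choosing each
generator so late that the new limit points contribute little measure.

For the second half the limit points lie in `ℤ_[2]`: there are unavoidable sets near the limit point
that are small for all translates of all idempotents. Blocks of successors of measure at least `k`
whose values lie in the `k`-th neighbourhood of the limit point have a union of infinite measure,
and the union of their values is still small because idempotents converge 2-adically to `0`.
-/

open Filter Topology MeasureTheory
open scoped ENNReal NNReal

namespace GamifiedKatetov

attribute [local instance] Ultrafilter.add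

/-! ### Paths and unavoidable sets -/

theorem initSeg_succ (p : ℕ → ℕ) (n : ℕ) : initSeg p (n + 1) = initSeg p n ++ [p n] := by
  simp [initSeg, List.range_succ]

theorem initSeg_prefix (p : ℕ → ℕ) {m n : ℕ} (h : m ≤ n) : initSeg p m <+: initSeg p n := by
  induction n, h using Nat.le_induction with
  | base => exact List.prefix_rfl
  | succ n _ ih => exact initSeg_succ p n ▸ ih.trans (List.prefix_append _ _)

theorem initSeg_length_dite (σ : List ℕ) (q : ℕ → ℕ) :
    initSeg (fun i => if h : i < σ.length then σ[i] else q (i - σ.length)) σ.length = σ := by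
  apply List.ext_getElem
  · simp [initSeg]
  · intro i _ hi
    simp [initSeg, hi]

theorem exists_path_of_forall_exists_append {Q : List ℕ → Prop} {σ : List ℕ} (hσ : Q σ)
    (hQ : ∀ τ, Q τ → ∃ n, Q (τ ++ [n])) :
    ∃ p : ℕ → ℕ, initSeg p σ.length = σ ∧ ∀ k, Q (initSeg p (σ.length + k)) := by
  choose! next hnext using hQ
  let s : ℕ → List ℕ := fun k => Nat.rec σ (fun _ τ => τ ++ [next τ]) k
  have hs : ∀ k, Q (s k) := fun k => Nat.rec hσ (fun _ ih => hnext _ ih) k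
  let p : ℕ → ℕ := fun i => if h : i < σ.length then σ[i] else next (s (i - σ.length))
  have hp : ∀ k, initSeg p (σ.length + k) = s k := by
    intro k
    induction k with
    | zero => exact initSeg_length_dite σ fun i => next (s i)
    | succ k ih =>
      rw [← add_assoc, initSeg_succ, ih]
      simp [p, s]
  exact ⟨p, hp 0, fun k => hp k ▸ hs k⟩

theorem bar_induction {T : Set (List ℕ)} {l : Filter ℕ} {G : List ℕ → Prop} (hroot : [] ∈ T)
    (hT : ∀ σ ∈ T, ∀ᶠ n in l, σ ++ [n] ∈ T) (hbar : ∀ p ∈ paths T, ∃ n, G (initSeg p n))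
    (hnode : ∀ σ, (∀ᶠ n in l, G (σ ++ [n])) → G σ) : G [] := by
  by_contra hG
  have hstep : ∀ σ, σ ∈ T ∧ ¬ G σ → ∃ n, σ ++ [n] ∈ T ∧ ¬ G (σ ++ [n]) := by
    rintro σ ⟨hσ, hGσ⟩
    have hfreq : ∃ᶠ n in l, ¬ G (σ ++ [n]) := not_eventually.1 (mt (hnode σ) hGσ)
    exact (hfreq.and_eventually (hT σ hσ)).exists.imp fun _ h => h.symm
  obtain ⟨p, -, hp⟩ := exists_path_of_forall_exists_append ⟨hroot, hG⟩ hstep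
  simp only [List.length_nil, zero_add] at hp
  obtain ⟨n, hn⟩ := hbar p fun n => (hp n).1
  exact (hp n).2 hn

variable {I J : LowerSet (Set ℕ)} {Φ : (ℕ → ℕ) →. ℕ} {S : Set ℕ} {σ : List ℕ}

/-- The sets `S` that cannot be avoided by `Φ` beyond the node `σ`: every tree through `σ` that
branches into the dual of `J` has a path on which `Φ` takes a value in `S`. -/
def unavoidable (J : LowerSet (Set ℕ)) (Φ : (ℕ → ℕ) →. ℕ) (σ : List ℕ) : UpperSet (Set ℕ) where
  carrier := {S | ∀ T, IsBranchingTree (dual J) T → σ ∈ T → ∃ p ∈ paths T, ∃ c ∈ Φ p, c ∈ S}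
  upper' _ _ hSS' hS T hT hσ :=
    have ⟨p, hp, c, hc, hcS⟩ := hS T hT hσ
    ⟨p, hp, c, hc, hSS' hcS⟩

theorem IsBranchingTree.exists_append_mem {T : Set (List ℕ)} (hT : IsBranchingTree (dual J) T)
    (hσ : σ ∈ T) {A : Set ℕ} (hA : A ∉ J) : ∃ n ∈ A, σ ++ [n] ∈ T := by
  by_contra! h
  exact hA (J.lower h (hT.branching σ hσ))

theorem singleton_mem_unavoidable (hJ : Set.univ ∉ J) {c : ℕ}
    (hc : ∀ p, initSeg p σ.length = σ → c ∈ Φ p) : {c} ∈ unavoidable J Φ σ := by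
  intro T hT hσ
  obtain ⟨p, hpσ, hpT⟩ := exists_path_of_forall_exists_append (Q := (· ∈ T)) hσ
    fun τ hτ => (hT.exists_append_mem hτ hJ).imp fun _ h => h.2
  refine ⟨p, fun n => ?_, c, hc p hpσ, rfl⟩
  exact hT.isTree.mem_of_prefix _ _ (initSeg_prefix p (Nat.le_add_left n σ.length)) (hpT n)

theorem mem_unavoidable_of_notMem (h : {n | S ∈ unavoidable J Φ (σ ++ [n])} ∉ J) :
    S ∈ unavoidable J Φ σ := by
  intro T hT hσ
  obtain ⟨n, hn, hnT⟩ := hT.exists_append_mem hσ h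
  exact hn T hT hnT

theorem exists_tendsto_nhds {α X : Type*} [TopologicalSpace X] [CompactSpace X]
    (q : Ultrafilter α) (f : α → X) : ∃ x, Tendsto f q (𝓝 x) :=
  ⟨(q.map f).lim, (q.map f).le_nhds_lim⟩

/-- Each family `unavoidable J Φ σ` is given a limit point in a compact space `X`, by recursion on
the well-founded tree of strings on which `Φ` is undecided: an ultralimit at the inner nodes. -/
theorem not_lowerLE_of_limitPoint {X : Type*} [TopologicalSpace X] [CompactSpace X]
    {q : Ultrafilter ℕ} (hq : ∀ A ∈ q, A ∉ J) (LimitPoint : UpperSet (Set ℕ) → X → Prop)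
    (hleaf : ∀ 𝒱 (c : ℕ), {c} ∈ 𝒱 → ∃ x, LimitPoint 𝒱 x)
    (hnode : ∀ 𝒱 (𝒲 : ℕ → UpperSet (Set ℕ)) f x, (∀ S, {n | S ∈ 𝒲 n} ∉ J → S ∈ 𝒱) →
      Tendsto f q (𝓝 x) → (∀ᶠ n in q, LimitPoint (𝒲 n) (f n)) → LimitPoint 𝒱 x)
    (hroot : ∀ 𝒱 x, LimitPoint 𝒱 x → ∃ S ∈ 𝒱, S ∈ I) : ¬ LowerLE I J := by
  rintro ⟨Φ, ⟨φ, -, hφ⟩, hΦ⟩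
  have hempty : ∅ ∈ I := by
    obtain ⟨x, hx⟩ := hleaf ⊥ 0 trivial
    obtain ⟨S, -, hS⟩ := hroot ⊥ x hx
    exact I.lower (Set.empty_subset S) hS
  obtain ⟨T, hT, hdom, -⟩ := hΦ Set.univ (show Set.univᶜ ∈ I by rwa [Set.compl_univ])
  obtain ⟨x, hx⟩ : ∃ x, LimitPoint (unavoidable J Φ []) x := by
    refine bar_induction (l := q) (G := fun σ => ∃ x, LimitPoint (unavoidable J Φ σ) x)
      hT.isTree.root_mem ?_ ?_ ?_
    · exact fun σ hσ => Ultrafilter.compl_notMem_iff.1 fun h => hq _ h (hT.branching σ hσ)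
    · intro p hp
      obtain ⟨c, hc⟩ := Part.dom_iff_mem.1 (hdom hp)
      obtain ⟨n, hn⟩ := (hφ p c).1 hc
      refine ⟨n, hleaf _ c (singleton_mem_unavoidable (hq _ univ_mem) fun p' hp' => ?_)⟩
      exact (hφ p' c).2 ⟨_, hp'.symm ▸ hn⟩
    · intro σ hσ
      obtain ⟨f, hf⟩ := hσ.choice
      obtain ⟨x, hx⟩ := exists_tendsto_nhds q f
      exact ⟨x, hnode _ _ f x (fun S => mem_unavoidable_of_notMem) hx hf⟩
  obtain ⟨S, hS, hSI⟩ := hroot _ x hx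
  obtain ⟨T', hT', -, hvalue⟩ := hΦ Sᶜ (show Sᶜᶜ ∈ I by rwa [compl_compl])
  obtain ⟨p, hp, c, hc, hcS⟩ := hS T' hT' hT'.isTree.root_mem
  exact hvalue p hp c hc hcS

/-! ### Idempotent ultrafilters -/

theorem tendsto_of_tendsto_add {M X : Type*} [Add M] [TopologicalSpace X] [RegularSpace X]
    {p q : Ultrafilter M} {f l : M → X} {x : X} (hf : Tendsto f ↑(p + q) (𝓝 x))
    (hl : ∀ a, Tendsto (fun b => f (a + b)) q (𝓝 (l a))) : Tendsto l p (𝓝 x) := by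
  refine (closed_nhds_basis x).tendsto_right_iff.2 fun C ⟨hC, hCclosed⟩ => ?_
  filter_upwards [(Ultrafilter.eventually_add p q (f · ∈ C)).1 (hf hC)] with a ha
  exact hCclosed.mem_of_tendsto (hl a) ha

/-- A non-principal idempotent of the semigroup `βℕ`. -/
structure IsFreeIdempotent (q : Ultrafilter ℕ) : Prop where
  add_self : q + q = q
  le_atTop : (q : Filter ℕ) ≤ atTop

theorem isFreeIdempotent_of_eventually_ne_zero {q : Ultrafilter ℕ} (hadd : q + q = q)
    (hne : ∀ᶠ n in (q : Filter ℕ), n ≠ 0) : IsFreeIdempotent q := by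
  refine ⟨hadd, Nat.cofinite_eq_atTop ▸ q.le_cofinite_or_eq_pure.resolve_right ?_⟩
  rintro ⟨a, rfl⟩
  have haa : ∀ᶠ n in (pure a + pure a : Ultrafilter ℕ), n = a := by
    rw [hadd]
    exact (rfl : a = a)
  have haa : a + a = a := (Ultrafilter.eventually_add _ _ _).1 haa
  exact (hne : a ≠ 0) (add_eq_left.1 haa)

theorem exists_sum_get_of_mem_FS {M : Type*} [AddCommMonoid M] {a : Stream' M} {m : M}
    (hm : m ∈ Hindman.FS a) : ∃ F : Finset ℕ, F.Nonempty ∧ m = ∑ i ∈ F, a.get i := by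
  induction hm with
  | head' a => exact ⟨{0}, by simp, by simp [Stream'.head]⟩
  | tail' a m _ ih =>
    obtain ⟨F, hF, rfl⟩ := ih
    exact ⟨F.map (addRightEmbedding 1), by simpa, by simp [Stream'.get_tail]⟩
  | cons' a m _ ih =>
    obtain ⟨F, -, rfl⟩ := ih
    exact ⟨insert 0 (F.map (addRightEmbedding 1)), by simp,
      by simp [Stream'.get_tail, Stream'.head]⟩

theorem exists_isFreeIdempotent_finiteSums_mem {B : Set ℕ} (hB : B.Infinite) :
    ∃ q : Ultrafilter ℕ, IsFreeIdempotent q ∧ finiteSums B ∈ q := by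
  let e := (hB.sdiff (Set.finite_singleton 0)).natEmbedding
  let a : Stream' ℕ := fun n => (e n : ℕ)
  have ha : Function.Injective a.get := fun i j h => e.injective (Subtype.ext h)
  obtain ⟨q, hadd, hqa⟩ := Hindman.exists_idempotent_ultrafilter_le_FS a
  refine ⟨q, isFreeIdempotent_of_eventually_ne_zero hadd ?_, ?_⟩ <;>
    filter_upwards [hqa] with m hm <;> obtain ⟨F, ⟨i, hi⟩, rfl⟩ := exists_sum_get_of_mem_FS hm
  · exact fun h0 => (e i).2.2 (Finset.sum_eq_zero_iff.1 h0 i hi)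
  · refine ⟨F.map ⟨a.get, ha⟩, ⟨a.get i, Finset.mem_map_of_mem _ hi⟩, ?_, by simp⟩
    rw [Finset.coe_map, Set.image_subset_iff]
    exact fun j _ => (e j).2.1

namespace IsFreeIdempotent

variable {q : Ultrafilter ℕ}

theorem eventually_iff (hq : IsFreeIdempotent q) {P : ℕ → Prop} :
    (∀ᶠ n in q, P n) ↔ ∀ᶠ m in q, ∀ᶠ n in q, P (m + n) := by
  conv_lhs => rw [← hq.add_self]
  exact Ultrafilter.eventually_add q q P

theorem eventually_translate (hq : IsFreeIdempotent q) {A : Set ℕ} {x : ℕ}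
    (hx : ∀ᶠ n in q, x + n ∈ A) : ∀ᶠ m in q, x + m ∈ A ∧ ∀ᶠ n in q, x + m + n ∈ A := by
  filter_upwards [hx, hq.eventually_iff.1 hx] with m hm hmn
  exact ⟨hm, by simpa only [add_assoc] using hmn⟩

theorem tendsto_translate_limit (hq : IsFreeIdempotent q) {X : Type*} [TopologicalSpace X]
    [RegularSpace X] {f l : ℕ → X} (hl : ∀ x, Tendsto (fun n => f (x + n)) q (𝓝 (l x))) (x : ℕ) :
    Tendsto (fun n => l (x + n)) q (𝓝 (l x)) :=
  tendsto_of_tendsto_add (f := fun n => f (x + n)) (by rw [hq.add_self]; exact hl x)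
    fun m => by simpa only [add_assoc] using hl (x + m)

theorem tendsto_addMonoidHom (hq : IsFreeIdempotent q) {G : Type*} [AddGroup G]
    [TopologicalSpace G] [ContinuousAdd G] [CompactSpace G] [T2Space G] (ι : ℕ →+ G) :
    Tendsto ι q (𝓝 0) := by
  obtain ⟨L, hL⟩ := exists_tendsto_nhds q ι
  have htranslate : ∀ x, Tendsto (fun n => ι (x + n)) q (𝓝 (ι x + L)) := fun x => by
    simpa only [map_add] using hL.const_add (ι x)
  have hlimit : Tendsto (fun n => ι n + L) q (𝓝 L) := by
    simpa using hq.tendsto_translate_limit htranslate 0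
  have hLL : L + L = L := tendsto_nhds_unique (hL.add_const L) hlimit
  rwa [add_eq_left.1 hLL] at hL

end IsFreeIdempotent

/-! ### Infinite sets whose finite sums are controlled -/

theorem exists_strictMono_forall_subset_image {l : Filter ℕ} [l.NeBot] (hl : l ≤ atTop)
    {R : ℕ → Finset ℕ → ℕ → Prop} (hR : ∀ n F, ∀ᶠ b in l, R n F b) :
    ∃ b : ℕ → ℕ, StrictMono b ∧ ∀ n, ∀ F ⊆ (Finset.range n).image b, R n F (b n) := by
  have hnext : ∀ n (s : Finset ℕ), ∃ b, (∀ a ∈ s, a < b) ∧ ∀ F ∈ s.powerset, R n F b := fun n s =>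
    (((Finset.eventually_all s).2 fun a _ => hl (eventually_gt_atTop a)).and
      ((Finset.eventually_all s.powerset).2 fun F _ => hR n F)).exists
  choose g hgt hgR using hnext
  let s : ℕ → Finset ℕ := fun n => Nat.rec ∅ (fun n t => insert (g n t) t) n
  let b : ℕ → ℕ := fun n => g n (s n)
  have hs : ∀ n, s n = (Finset.range n).image b := by
    intro n
    induction n with
    | zero => rfl
    | succ n ih => rw [Finset.range_add_one, Finset.image_insert, ← ih]
  refine ⟨b, strictMono_nat_of_lt_succ fun n => hgt (n + 1) _ _ (Finset.mem_insert_self _ _),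
    fun n F hF => hgR n (s n) F ?_⟩
  rwa [Finset.mem_powerset, hs]

section StrictMono

variable {b : ℕ → ℕ}

theorem coe_subset_range_of_subset_image {F s : Finset ℕ} (hF : F ⊆ s.image b) :
    (F : Set ℕ) ⊆ Set.range b := by
  refine (Finset.coe_subset.2 hF).trans ?_
  rw [Finset.coe_image]
  exact Set.image_subset_range b s

theorem subset_image_range_of_forall_lt (hb : StrictMono b) {F : Finset ℕ}
    (hF : (F : Set ℕ) ⊆ Set.range b) {n : ℕ} (hlt : ∀ a ∈ F, a < b n) :
    F ⊆ (Finset.range n).image b := by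
  intro a ha
  obtain ⟨i, rfl⟩ := hF ha
  exact Finset.mem_image_of_mem b (Finset.mem_range.2 (hb.lt_iff_lt.1 (hlt _ ha)))

theorem sum_induction_of_strictMono (hb : StrictMono b) {Q : ℕ → Prop} (hzero : Q 0)
    (hadd : ∀ n, ∀ F ⊆ (Finset.range n).image b, Q (∑ i ∈ F, i) → Q (∑ i ∈ F, i + b n))
    (F : Finset ℕ) (hF : (F : Set ℕ) ⊆ Set.range b) : Q (∑ i ∈ F, i) := by
  induction F using Finset.induction_on_max with
  | empty => simpa using hzero
  | insert a F hlt ih =>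
    rw [Finset.coe_insert, Set.insert_subset_iff] at hF
    obtain ⟨⟨n, rfl⟩, hF⟩ := hF
    rw [Finset.sum_insert fun h => (hlt _ h).false, add_comm]
    exact hadd n F (subset_image_range_of_forall_lt hb hF hlt) (ih hF)

theorem exists_eq_sum_add_of_mem_finiteSums (hb : StrictMono b) {y : ℕ}
    (hy : y ∈ finiteSums (Set.range b)) :
    ∃ n, ∃ F ⊆ (Finset.range n).image b, y = ∑ i ∈ F, i + b n := by
  obtain ⟨F, hF, hFb, rfl⟩ := hy
  obtain ⟨n, hn⟩ := hFb (F.max'_mem hF)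
  refine ⟨n, F.erase (F.max' hF), subset_image_range_of_forall_lt hb ?_ ?_, ?_⟩
  · exact (Finset.coe_subset.2 (F.erase_subset _)).trans hFb
  · exact fun a ha => hn ▸ F.lt_max'_of_mem_erase_max' hF ha
  · rw [hn, Finset.sum_erase_add F (fun i => i) (F.max'_mem hF)]

theorem finiteSums_range_subset (hb : StrictMono b) {A : Set ℕ} {Q : ℕ → Prop} (hzero : Q 0)
    (hadd : ∀ n, ∀ F ⊆ (Finset.range n).image b, Q (∑ i ∈ F, i) →
      ∑ i ∈ F, i + b n ∈ A ∧ Q (∑ i ∈ F, i + b n)) : finiteSums (Set.range b) ⊆ A := by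
  intro y hy
  obtain ⟨n, F, hF, rfl⟩ := exists_eq_sum_add_of_mem_finiteSums hb hy
  exact (hadd n F hF (sum_induction_of_strictMono hb hzero (fun n F hF h => (hadd n F hF h).2) F
    (coe_subset_range_of_subset_image hF))).1

theorem image_finiteSums_range_diff_subset (hb : StrictMono b) {X : Type*} {f l : ℕ → X}
    {U : Set X} (hU : ∀ n, ∀ F ⊆ (Finset.range n).image b,
      {f (∑ i ∈ F, i + b n), l (∑ i ∈ F, i + b n)} \ {l (∑ i ∈ F, i)} ⊆ U) :
    f '' finiteSums (Set.range b) \ {l 0} ⊆ U := by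
  have hl : ∀ F : Finset ℕ, (F : Set ℕ) ⊆ Set.range b → l (∑ i ∈ F, i) ∈ insert (l 0) U := by
    refine sum_induction_of_strictMono hb (Q := fun y => l y ∈ insert (l 0) U) (Or.inl rfl)
      fun n F hF ih => ?_
    by_cases h : l (∑ i ∈ F, i + b n) = l (∑ i ∈ F, i)
    · rwa [h]
    · exact Or.inr (hU n F hF ⟨Or.inr rfl, h⟩)
  rintro _ ⟨⟨y, hy, rfl⟩, hne⟩
  obtain ⟨n, F, hF, rfl⟩ := exists_eq_sum_add_of_mem_finiteSums hb hy
  by_cases h : f (∑ i ∈ F, i + b n) = l (∑ i ∈ F, i)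
  · exact h ▸ (hl F (coe_subset_range_of_subset_image hF)).resolve_left (h ▸ hne)
  · exact hU n F hF ⟨Or.inl rfl, h⟩

end StrictMono

section Measure

variable {μ : Measure ℕ}

theorem tendsto_measure_natCast_preimage_diff (hμ : Tendsto (fun n => μ {n}) atTop (𝓝 0))
    (v : ℕ∞) : Tendsto (fun u : ℕ∞ => μ ((↑) ⁻¹' ({u} \ {v}))) (𝓝 v) (𝓝 0) := by
  rcases eq_or_ne v ⊤ with rfl | hv
  · refine ENNReal.tendsto_nhds_zero.2 fun ε hε => ?_
    obtain ⟨N, hN⟩ := eventually_atTop.1 (ENNReal.tendsto_nhds_zero.1 hμ ε hε)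
    filter_upwards [Ioi_mem_nhds (ENat.natCast_lt_top N)] with u hu
    cases u with
    | top => simp
    | coe n =>
      refine le_trans (measure_mono ?_) (hN n (ENat.natCast_lt_natCast.1 hu).le)
      exact fun m hm => Nat.cast_injective hm.1
  · rw [ENat.nhds_eq_pure hv, tendsto_pure_left]
    intro s hs
    simpa using mem_of_mem_nhds hs

theorem measure_iUnion_iUnion_prop_le {ι α : Type*} [Countable ι] [MeasurableSpace α]
    (ν : Measure α) {P : ι → Prop} {s : ι → Set α} {δ : ι → ℝ≥0∞} (h : ∀ i, P i → ν (s i) ≤ δ i) :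
    ν (⋃ i, ⋃ _ : P i, s i) ≤ ∑' i, δ i := by
  refine (measure_iUnion_le _).trans (ENNReal.tsum_le_tsum fun i => ?_)
  by_cases hi : P i <;> simp [hi, h]

theorem IsFreeIdempotent.eventually_measure_preimage_diff_le {q : Ultrafilter ℕ}
    (hq : IsFreeIdempotent q) (hμ : Tendsto (fun n => μ {n}) atTop (𝓝 0)) {f l : ℕ → ℕ∞}
    (hl : ∀ x, Tendsto (fun n => f (x + n)) q (𝓝 (l x))) (x : ℕ) {ε : ℝ≥0∞} (hε : 0 < ε) :
    ∀ᶠ b in q, μ ((↑) ⁻¹' ({f (x + b), l (x + b)} \ {l x})) ≤ ε := by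
  have hjump := tendsto_measure_natCast_preimage_diff hμ (l x)
  have hsum := (hjump.comp (hl x)).add (hjump.comp (hq.tendsto_translate_limit hl x))
  rw [add_zero] at hsum
  filter_upwards [ENNReal.tendsto_nhds_zero.1 hsum ε hε] with b hb
  rw [Set.insert_eq, Set.union_sdiff_distrib, Set.preimage_union]
  exact (measure_union_le _ _).trans hb

/-- The Galvin–Glazer construction of `B`, in which each new generator `b` also keeps the
values `f (x + b)` and their limits along `q` close to the limit at `x`, for every finite sum `x`
of the previous generators. -/
theorem IsFreeIdempotent.exists_finiteSums_subset {q : Ultrafilter ℕ} (hq : IsFreeIdempotent q)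
    (hμ : Tendsto (fun n => μ {n}) atTop (𝓝 0)) {A : Set ℕ} (hA : A ∈ q) {f : ℕ → ℕ∞} {v : ℕ∞}
    (hf : Tendsto f q (𝓝 v)) {ε : ℝ≥0∞} (hε : ε ≠ 0) :
    ∃ B : Set ℕ, B.Infinite ∧ finiteSums B ⊆ A ∧ μ ((↑) ⁻¹' (f '' finiteSums B \ {v})) ≤ ε := by
  choose l hl using fun x => exists_tendsto_nhds q fun n => f (x + n)
  obtain rfl : l 0 = v := tendsto_nhds_unique (by simpa using hl 0) hf
  obtain ⟨δ, hδ, hδε⟩ := ENNReal.exists_pos_sum_of_countable' hε (ℕ × Finset ℕ)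
  let jump : Finset ℕ → ℕ → Set ℕ∞ := fun F b =>
    {f (∑ i ∈ F, i + b), l (∑ i ∈ F, i + b)} \ {l (∑ i ∈ F, i)}
  have hreturn : ∀ x, ∀ᶠ b in q, (∀ᶠ y in q, x + y ∈ A) →
      x + b ∈ A ∧ ∀ᶠ y in q, x + b + y ∈ A := fun x =>
    eventually_imp_distrib_left.2 hq.eventually_translate
  obtain ⟨b, hb, hbR⟩ := exists_strictMono_forall_subset_image hq.le_atTop fun n F =>
    (hreturn (∑ i ∈ F, i)).and (hq.eventually_measure_preimage_diff_le hμ hl _ (hδ (n, F)))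
  refine ⟨Set.range b, Set.infinite_range_of_injective hb.injective, ?_, ?_⟩
  · exact finiteSums_range_subset hb (Q := fun x => ∀ᶠ y in q, x + y ∈ A) (by simpa)
      fun n F hF => (hbR n F hF).1
  · let P : ℕ × Finset ℕ → Prop := fun i => i.2 ⊆ (Finset.range i.1).image b
    have hsubset : f '' finiteSums (Set.range b) \ {l 0} ⊆ ⋃ i, ⋃ _ : P i, jump i.2 (b i.1) :=
      image_finiteSums_range_diff_subset hb fun n F hF =>
        Set.subset_iUnion₂_of_subset (n, F) hF subset_rfl
    have hmeasure : ∀ i, P i → μ ((↑) ⁻¹' jump i.2 (b i.1)) ≤ δ i := by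
      rintro ⟨n, F⟩ hF
      exact (hbR n F hF).2
    calc μ ((↑) ⁻¹' (f '' finiteSums (Set.range b) \ {l 0}))
        ≤ μ (⋃ i, ⋃ _ : P i, (↑) ⁻¹' jump i.2 (b i.1)) := by
          simpa only [Set.preimage_iUnion] using measure_mono (Set.preimage_mono hsubset)
      _ ≤ ∑' i, δ i := measure_iUnion_iUnion_prop_le μ hmeasure
      _ ≤ ε := hδε.le

end Measure

theorem IsFreeIdempotent.notMem_hindmanIdeal {q : Ultrafilter ℕ} (hq : IsFreeIdempotent q)
    {A : Set ℕ} (hA : A ∈ q) : A ∉ hindmanIdeal := fun h => by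
  obtain ⟨B, hB, hBA, -⟩ := hq.exists_finiteSums_subset (μ := 0) (by simp) hA
    (tendsto_const_nhds (x := ⊤)) one_ne_zero
  exact h B hB hBA

/-! ### Ideals of sets of finite measure -/

/-- The ideal of sets of finite measure. Measures on `ℕ` are atomic, so this is the
summable ideal with weights `μ {n}`. -/
def finiteMeasureIdeal (μ : Measure ℕ) : LowerSet (Set ℕ) where
  carrier := {A | μ A < ∞}
  lower' _ _ hBA hA := (measure_mono hBA).trans_lt hA

variable {μ : Measure ℕ}

/-- The family `𝒱` has members of arbitrarily small measure apart from the point `v`. For `v = ⊤`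
nothing is left out: the preimage of `{⊤}` under the coercion `ℕ → ℕ∞` is empty. -/
def ConcentratesAt (μ : Measure ℕ) (𝒱 : UpperSet (Set ℕ)) (v : ℕ∞) : Prop :=
  ∀ ε ≠ 0, ∃ S ∈ 𝒱, μ (S \ (↑) ⁻¹' {v}) ≤ ε

theorem natCast_preimage_singleton (n : ℕ) : ((↑) : ℕ → ℕ∞) ⁻¹' {(n : ℕ∞)} = {n} := by
  ext m
  simp

theorem ConcentratesAt.exists_measure_lt_top {𝒱 : UpperSet (Set ℕ)} {v : ℕ∞}
    (h : ConcentratesAt μ 𝒱 v) (hfin : ∀ n, μ {n} < ∞) : ∃ S ∈ 𝒱, μ S < ∞ := by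
  obtain ⟨S, hS, hSv⟩ := h 1 one_ne_zero
  have hpoint : μ ((↑) ⁻¹' {v}) < ∞ := by
    cases v with
    | top => simp [Set.preimage]
    | coe n => rw [natCast_preimage_singleton]; exact hfin n
  refine ⟨S, hS, ?_⟩
  calc μ S ≤ μ (S \ (↑) ⁻¹' {v}) + μ ((↑) ⁻¹' {v}) :=
        (measure_mono (Set.subset_sdiff_union S _)).trans (measure_union_le _ _)
    _ < ∞ := ENNReal.add_lt_top.2 ⟨hSv.trans_lt ENNReal.one_lt_top, hpoint⟩

theorem ConcentratesAt.of_tendsto {q : Ultrafilter ℕ} (hq : IsFreeIdempotent q)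
    (hμ : Tendsto (fun n => μ {n}) atTop (𝓝 0)) {𝒱 : UpperSet (Set ℕ)}
    {𝒲 : ℕ → UpperSet (Set ℕ)} {f : ℕ → ℕ∞} {v : ℕ∞}
    (h𝒱 : ∀ S, {n | S ∈ 𝒲 n} ∉ hindmanIdeal → S ∈ 𝒱) (hf : Tendsto f q (𝓝 v))
    (h𝒲 : ∀ᶠ n in q, ConcentratesAt μ (𝒲 n) (f n)) : ConcentratesAt μ 𝒱 v := by
  intro ε hε
  have hε2 : ε / 2 ≠ 0 := (ENNReal.half_pos hε).ne'
  obtain ⟨B, hB, hB𝒲, hBε⟩ := hq.exists_finiteSums_subset hμ h𝒲 hf hε2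
  obtain ⟨δ, hδ, hδε⟩ := ENNReal.exists_pos_sum_of_countable' hε2 ℕ
  choose! S hS hSδ using fun n hn => hB𝒲 hn (δ n) (hδ n).ne'
  refine ⟨⋃ n ∈ finiteSums B, S n, h𝒱 _ fun hsmall => hsmall B hB fun n hn =>
    (𝒲 n).upper (Set.subset_biUnion_of_mem hn) (hS n hn), ?_⟩
  have hcover : (⋃ n ∈ finiteSums B, S n) \ (↑) ⁻¹' {v} ⊆
      (⋃ n, ⋃ _ : n ∈ finiteSums B, S n \ (↑) ⁻¹' {f n}) ∪
        (↑) ⁻¹' (f '' finiteSums B \ {v}) := by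
    rintro c ⟨hc, hcv⟩
    obtain ⟨n, hn, hcn⟩ := Set.mem_iUnion₂.1 hc
    by_cases hcf : (c : ℕ∞) = f n
    · exact Or.inr ⟨⟨n, hn, hcf.symm⟩, hcv⟩
    · exact Or.inl (Set.mem_biUnion hn ⟨hcn, hcf⟩)
  calc μ ((⋃ n ∈ finiteSums B, S n) \ (↑) ⁻¹' {v})
      ≤ ∑' n, δ n + ε / 2 := (measure_mono hcover).trans <| (measure_union_le _ _).trans <|
        add_le_add (measure_iUnion_iUnion_prop_le μ hSδ) hBε
    _ ≤ ε / 2 + ε / 2 := by gcongr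
    _ = ε := ENNReal.add_halves ε

theorem not_lowerLE_finiteMeasureIdeal_hindmanIdeal
    (hμ : Tendsto (fun n => μ {n}) atTop (𝓝 0)) (hfin : ∀ n, μ {n} < ∞) :
    ¬ LowerLE (finiteMeasureIdeal μ) hindmanIdeal := by
  obtain ⟨q, hq, -⟩ := exists_isFreeIdempotent_finiteSums_mem Set.infinite_univ
  refine not_lowerLE_of_limitPoint (fun _ => hq.notMem_hindmanIdeal) (ConcentratesAt μ) ?_ ?_ ?_
  · exact fun 𝒱 c hc => ⟨c, fun ε _ => ⟨{c}, hc, by simp [natCast_preimage_singleton]⟩⟩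
  · exact fun 𝒱 𝒲 f v h𝒱 hf h𝒲 => ConcentratesAt.of_tendsto hq hμ h𝒱 hf h𝒲
  · exact fun 𝒱 v h => h.exists_measure_lt_top hfin

/-! ### The Hindman ideal is not below an ideal of sets of finite measure -/

/-- No translate of `Y` is large for a non-principal idempotent ultrafilter. Without the
translations `z` this would be membership in the Hindman ideal. -/
def IsTranslateSmall (Y : Set ℕ) : Prop :=
  ∀ q : Ultrafilter ℕ, IsFreeIdempotent q → ∀ z, ¬ ∀ᶠ n in q, z + n ∈ Y

theorem IsTranslateSmall.mem_hindmanIdeal {Y : Set ℕ} (hY : IsTranslateSmall Y) :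
    Y ∈ hindmanIdeal := by
  intro B hB hBY
  obtain ⟨q, hq, hqB⟩ := exists_isFreeIdempotent_finiteSums_mem hB
  refine hY q hq 0 ?_
  filter_upwards [hqB] with n hn
  simpa using hBY hn

theorem isTranslateSmall_singleton (c : ℕ) : IsTranslateSmall {c} := by
  intro q hq z h
  obtain ⟨n, hzn, hcn⟩ := (h.and (hq.le_atTop (eventually_gt_atTop c))).exists
  exact (hcn.trans_le (Nat.le_add_left n z)).ne' hzn

theorem isTranslateSmall_biUnion_finset {κ : Type*} (F : Finset κ) {Y : κ → Set ℕ}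
    (hY : ∀ i ∈ F, IsTranslateSmall (Y i)) : IsTranslateSmall (⋃ i ∈ F, Y i) := by
  intro q hq z h
  have havoid : ∀ᶠ n in q, ∀ i ∈ F, z + n ∉ Y i :=
    (Finset.eventually_all F).2 fun i hi => Ultrafilter.eventually_not.2 (hY i hi q hq z)
  obtain ⟨n, hn, hnF⟩ := (h.and havoid).exists
  obtain ⟨i, hi, hni⟩ := Set.mem_iUnion₂.1 hn
  exact hnF i hi hni

theorem exists_finset_le_measure {A : Set ℕ} (hA : μ A = ∞) (k : ℕ) :
    ∃ F : Finset ℕ, (F : Set ℕ) ⊆ A ∧ (k : ℝ≥0∞) ≤ μ F := by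
  have hmono : Monotone fun n : ℕ => A ∩ Set.Iio n := fun m n h =>
    Set.inter_subset_inter_right _ (Set.Iio_subset_Iio h)
  have hsup : ⨆ n, μ (A ∩ Set.Iio n) = ∞ := by
    rw [← hmono.measure_iUnion, ← Set.inter_iUnion, Set.iUnion_Iio, Set.inter_univ, hA]
  obtain ⟨n, hn⟩ := lt_iSup_iff.1 (hsup ▸ ENNReal.natCast_lt_top k)
  have hfin : (A ∩ Set.Iio n).Finite := (Set.finite_Iio n).inter_of_right A
  exact ⟨hfin.toFinset, by simp, by simpa using hn.le⟩

section MeasurableSpace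

variable {α : Type*} [MeasurableSpace α] {ν : Measure α}

theorem measure_iUnion_eq_top {A : ℕ → Set α} (hA : ∀ k : ℕ, (k : ℝ≥0∞) ≤ ν (A k)) :
    ν (⋃ k, A k) = ∞ := by
  refine ENNReal.eq_top_of_forall_nnreal_le fun r => ?_
  obtain ⟨k, hk⟩ := exists_nat_ge r
  calc (r : ℝ≥0∞) ≤ (k : ℝ≥0∞) := by exact_mod_cast hk
    _ ≤ ν (A k) := hA k
    _ ≤ ν (⋃ k, A k) := measure_mono (Set.subset_iUnion A k)

theorem measure_eq_top_of_mem_of_le_cofinite {q : Ultrafilter α}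
    (hq : (q : Filter α) ≤ ν.cofinite) {A : Set α} (hA : A ∈ q) : ν A = ∞ := by
  by_contra hne
  exact Ultrafilter.compl_mem_iff_notMem.1
    (hq (Measure.compl_mem_cofinite.2 (lt_top_iff_ne_top.2 hne))) hA

end MeasurableSpace

section CompactGroup

variable {G : Type*} [AddGroup G] [TopologicalSpace G] {ι : ℕ →+ G}

/-- Idempotents converge to `0` in `G`, so the translate by `z` of the union is far from `x`, hence
covered by finitely many of the sets, unless `ι z = x`; then some `z + m` takes the place of `z`. -/
theorem isTranslateSmall_iUnion [ContinuousAdd G] [CompactSpace G] [T2Space G]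
    (hι : Function.Injective ι) {x : G} {V : ℕ → Set G} (hV : (𝓝 x).HasAntitoneBasis V)
    {Z : ℕ → Set ℕ} (hZ : ∀ k, IsTranslateSmall (Z k)) (hZV : ∀ k, Set.MapsTo ι (Z k) (V k)) :
    IsTranslateSmall (⋃ k, Z k) := by
  intro q hq
  have hfar : ∀ z, ι z ≠ x → ¬ ∀ᶠ n in q, z + n ∈ ⋃ k, Z k := by
    intro z hzx h
    have hlim : Tendsto (fun n => ι (z + n)) q (𝓝 (ι z)) := by
      simpa using (hq.tendsto_addMonoidHom ι).const_add (ι z)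
    obtain ⟨K, hK⟩ : ∃ K, ∀ᶠ n in q, ι (z + n) ∉ V K := by
      obtain ⟨U, hU, W, hW, hUW⟩ := Filter.disjoint_iff.1 (disjoint_nhds_nhds.2 hzx)
      obtain ⟨K, hK⟩ := hV.mem_iff.1 hW
      refine ⟨K, (hlim.eventually_mem hU).mono fun n hn hnK => ?_⟩
      exact Set.disjoint_left.1 hUW hn (hK hnK)
    refine isTranslateSmall_biUnion_finset (Finset.range K) (fun k _ => hZ k) q hq z ?_
    filter_upwards [h, hK] with n hn hnK
    obtain ⟨k, hk⟩ := Set.mem_iUnion.1 hn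
    have hkK : k < K := lt_of_not_ge fun hKk => hnK (hV.antitone hKk (hZV k hk))
    exact Set.mem_biUnion (Finset.mem_coe.2 (Finset.mem_range.2 hkK)) hk
  intro z h
  by_cases hzx : ι z = x
  · obtain ⟨m, ⟨-, hm⟩, hm0⟩ :=
      ((hq.eventually_translate h).and (hq.le_atTop (eventually_ne_atTop 0))).exists
    refine hfar (z + m) (fun hzm => hm0 ?_) hm
    exact add_eq_left.1 (hι (hzm.trans hzx.symm))
  · exact hfar z hzx h

/-- The family `𝒱` has translate-small members arbitrarily close to `x`. -/
def IsTranslateSmallLimit (ι : ℕ →+ G) (𝒱 : UpperSet (Set ℕ)) (x : G) : Prop :=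
  ∀ U ∈ 𝓝 x, ∃ Y ∈ 𝒱, IsTranslateSmall Y ∧ Set.MapsTo ι Y U

theorem IsTranslateSmallLimit.of_tendsto [ContinuousAdd G] [CompactSpace G] [T2Space G]
    [FirstCountableTopology G] (hι : Function.Injective ι) {q : Ultrafilter ℕ}
    (hq : (q : Filter ℕ) ≤ μ.cofinite) {𝒱 : UpperSet (Set ℕ)} {𝒲 : ℕ → UpperSet (Set ℕ)}
    {f : ℕ → G} {x : G} (h𝒱 : ∀ S, {n | S ∈ 𝒲 n} ∉ finiteMeasureIdeal μ → S ∈ 𝒱)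
    (hf : Tendsto f q (𝓝 x)) (h𝒲 : ∀ᶠ n in q, IsTranslateSmallLimit ι (𝒲 n) (f n)) :
    IsTranslateSmallLimit ι 𝒱 x := by
  intro U hU
  obtain ⟨V, hV⟩ := (𝓝 x).exists_antitone_basis
  obtain ⟨K, hK⟩ := hV.mem_iff.1 hU
  have hVK : (𝓝 x).HasAntitoneBasis fun k => V (K + k) :=
    hV.comp_strictMono fun _ _ h => Nat.add_lt_add_left h K
  have hblock : ∀ k : ℕ, ∃ F : Finset ℕ, (k : ℝ≥0∞) ≤ μ F ∧ ∀ n ∈ F,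
      ∃ Y ∈ 𝒲 n, IsTranslateSmall Y ∧ Set.MapsTo ι Y (V (K + k)) := by
    intro k
    obtain ⟨F, hF, hFk⟩ := exists_finset_le_measure (measure_eq_top_of_mem_of_le_cofinite hq
      (h𝒲.and (hf.eventually (eventually_mem_nhds_iff.2 (hVK.mem k))))) k
    exact ⟨F, hFk, fun n hn => (hF hn).1 _ (hF hn).2⟩
  choose F hFk hF using hblock
  choose! Y hY𝒲 hYsmall hYV using hF
  have hmaps : ∀ k, Set.MapsTo ι (⋃ n ∈ F k, Y k n) (V (K + k)) := fun k =>
    Set.mapsTo_iUnion₂.2 (hYV k)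
  refine ⟨⋃ k, ⋃ n ∈ F k, Y k n, h𝒱 _ fun hfinite => ?_, ?_, ?_⟩
  · refine (measure_mono (Set.iUnion_subset fun k n hn => ?_)).trans_lt hfinite |>.ne
      (measure_iUnion_eq_top hFk)
    exact (𝒲 n).upper (Set.subset_iUnion_of_subset k (Set.subset_biUnion_of_mem hn))
      (hY𝒲 k n hn)
  · exact isTranslateSmall_iUnion hι hVK
      (fun k => isTranslateSmall_biUnion_finset (F k) (hYsmall k)) hmaps
  · exact Set.mapsTo_iUnion.2 fun k => (hmaps k).mono_right
      ((hV.antitone (Nat.le_add_right K k)).trans hK)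

end CompactGroup

theorem not_lowerLE_hindmanIdeal_finiteMeasureIdeal (htop : μ Set.univ = ∞) :
    ¬ LowerLE hindmanIdeal (finiteMeasureIdeal μ) := by
  have hneBot : μ.cofinite.NeBot := by
    rw [neBot_iff, Ne, ← empty_mem_iff_bot, Measure.mem_cofinite]
    simp [htop]
  have hq := Ultrafilter.of_le μ.cofinite
  refine not_lowerLE_of_limitPoint
    (fun A hA hfinite => hfinite.ne (measure_eq_top_of_mem_of_le_cofinite hq hA))
    (IsTranslateSmallLimit (Nat.castAddMonoidHom ℤ_[2])) ?_ ?_ ?_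
  · refine fun 𝒱 c hc => ⟨c, fun U hU => ⟨{c}, hc, isTranslateSmall_singleton c, ?_⟩⟩
    simpa using mem_of_mem_nhds hU
  · exact fun 𝒱 𝒲 f x h𝒱 hf h𝒲 => .of_tendsto Nat.cast_injective hq h𝒱 hf h𝒲
  · intro 𝒱 x h
    obtain ⟨Y, hY, hYsmall, -⟩ := h Set.univ univ_mem
    exact ⟨Y, hY, hYsmall.mem_hindmanIdeal⟩

/-! ### The canonical summable ideal -/

/-- The measure on `ℕ` with weights `1 / (n + 1)`. -/
noncomputable def harmonicMeasure : Measure ℕ :=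
  Measure.sum fun n : ℕ => ((1 / ((n : ℝ≥0) + 1) : ℝ≥0) : ℝ≥0∞) • Measure.dirac n

theorem harmonicMeasure_apply (A : Set ℕ) :
    harmonicMeasure A = ∑' n : A, ((1 / (((n : ℕ) : ℝ≥0) + 1) : ℝ≥0) : ℝ≥0∞) := by
  rw [harmonicMeasure, Measure.sum_apply _ .of_discrete,
    tsum_subtype A fun n : ℕ => ((1 / ((n : ℝ≥0) + 1) : ℝ≥0) : ℝ≥0∞)]
  congr with n
  by_cases hn : n ∈ A <;> simp [hn]

theorem harmonicMeasure_singleton (n : ℕ) :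
    harmonicMeasure {n} = ((1 / ((n : ℝ≥0) + 1) : ℝ≥0) : ℝ≥0∞) := by
  rw [harmonicMeasure_apply]
  exact tsum_singleton n fun n : ℕ => ((1 / ((n : ℝ≥0) + 1) : ℝ≥0) : ℝ≥0∞)

theorem harmonicMeasure_singleton_lt_top (n : ℕ) : harmonicMeasure {n} < ∞ :=
  harmonicMeasure_singleton n ▸ ENNReal.coe_lt_top

theorem harmonicMeasure_lt_top_iff {A : Set ℕ} :
    harmonicMeasure A < ∞ ↔ A ∈ canonicalSummableIdeal := by
  rw [harmonicMeasure_apply, lt_top_iff_ne_top, ENNReal.tsum_coe_ne_top_iff_summable_coe]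
  push_cast
  rfl

theorem canonicalSummableIdeal_eq_finiteMeasureIdeal :
    canonicalSummableIdeal = finiteMeasureIdeal harmonicMeasure :=
  LowerSet.ext (Set.ext fun _ => harmonicMeasure_lt_top_iff.symm)

theorem harmonicMeasure_univ : harmonicMeasure Set.univ = ∞ := by
  rw [← not_lt_top_iff, harmonicMeasure_lt_top_iff]
  intro h
  have hsum : Summable fun n : ℕ => 1 / ((n : ℝ) + 1) :=
    h.comp_injective (i := fun n => (⟨n, trivial⟩ : Set.univ)) fun _ _ => congrArg Subtype.val
  exact Real.not_summable_one_div_natCast ((summable_nat_add_iff 1).1 (by exact_mod_cast hsum))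

theorem tendsto_harmonicMeasure_singleton :
    Tendsto (fun n => harmonicMeasure {n}) atTop (𝓝 0) := by
  simp only [harmonicMeasure_singleton]
  exact ENNReal.tendsto_coe.2 tendsto_one_div_add_atTop_nhds_zero_nat

end GamifiedKatetov

theorem theoremB_general (μ : Measure ℕ) (hμ : Tendsto (fun n => μ {n}) atTop (𝓝 0))
    (hfin : ∀ n, μ {n} < ∞) (htop : μ Set.univ = ∞) :
    ¬ GamifiedKatetov.LowerLE (GamifiedKatetov.finiteMeasureIdeal μ)
        GamifiedKatetov.hindmanIdeal ∧
      ¬ GamifiedKatetov.LowerLE GamifiedKatetov.hindmanIdeal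
        (GamifiedKatetov.finiteMeasureIdeal μ) :=
  ⟨GamifiedKatetov.not_lowerLE_finiteMeasureIdeal_hindmanIdeal hμ hfin,
    GamifiedKatetov.not_lowerLE_hindmanIdeal_finiteMeasureIdeal htop⟩

theorem theoremB :
    ¬ GamifiedKatetov.LowerLE GamifiedKatetov.canonicalSummableIdeal GamifiedKatetov.hindmanIdeal ∧
    ¬ GamifiedKatetov.LowerLE GamifiedKatetov.hindmanIdeal GamifiedKatetov.canonicalSummableIdeal := by
  rw [GamifiedKatetov.canonicalSummableIdeal_eq_finiteMeasureIdeal]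
  exact theoremB_general _ GamifiedKatetov.tendsto_harmonicMeasure_singleton
    GamifiedKatetov.harmonicMeasure_singleton_lt_top GamifiedKatetov.harmonicMeasure_univ
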